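/- Let $D=(V,E)$ be a causal DAG on a finite node set, and let $X,Y,Z,S\subseteq V$ be pairwise disjoint (possibly empty) node sets with $Z\cap \mathrm{De}(X,D)=\emptyset$, where $\mathrm{De}(X,D)$ is the set of descendants of nodes of $X$ (each node is a descendant of itself). A path is a sequence of distinct nodes in which successive nodes are adjacent. A path from $X$ to $Y$ is proper if only its first node is in $X$, and it is a back-door path if it does not begin with an edge out of its first node. A node set $C$ blocks a path if some non-endpoint of the path is either a non-collider that belongs to $C$, or a collider that has no descendant in $C$. Suppose that $S$ satisfies the conditional back-door criterion relative to $(X,Y,Z)$ in $D$, i.e. (a) $S\cap \mathrm{De}(X,D)=\emptyset$, and (b) $S\cup Z$ blocks all proper back-door paths from $X$ to $Y$ in $D$. Then $S$ is a conditional adjustment set relative to $(X,Y,Z)$ in $D$, i.e. for every density $f$ consistent with $D$, $$ f(y\mid do(x),z)=\begin{cases} f(y\mid x,z) & \text{if } S=\emptyset,\\ \int f(y\mid x,z,s)\,f(s\mid z)\,ds & \text{if } S\neq\emptyset.\end{cases}$$ Here all densities are with respect to products of $\sigma$-finite reference measures on the (measurable, singletons measurable) state spaces of the variables. A density is consistent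 with $D$ if it belongs to a family of interventional densities $f(v\mid do(x'))$, $X'\subseteq V$ (with $f(v)$, a positive probability density, for $X'=\emptyset$), which satisfies for every $X'$ the truncated factorization $$ f(v\mid do(x'))=\prod_{V_i\in V\setminus X'} f(v_i\mid \mathrm{pa}(v_i,D))\,\mathbf 1(X'=x'), $$ where $\mathrm{pa}(v_i,D)$ denotes the values in $v$ of the parents of $V_i$ in $D$ and the densities on the right-hand side are conditional densities of $f(v)$. Equalities of densities hold almost everywhere with respect to the reference measures, both in the intervention value and in the remaining variables. -/

import Mathlib

open MeasureTheory
open scoped ENNReal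

universe u w

/-! ### Directed acyclic graphs, paths, blocking -/

/-- A directed graph without directed cycles. -/
def Digraph.IsDAG {V : Type*} (D : Digraph V) : Prop :=
  ∀ v, ¬ Relation.TransGen D.Adj v v

open Classical in
/-- The set of parents of the node `i`. -/
noncomputable def Digraph.parents {V : Type*} [Fintype V] (D : Digraph V) (i : V) : Finset V :=
  Finset.univ.filter fun j => D.Adj j i

/-- The descendants of the node set `X`; every node is a descendant of itself. -/
def Digraph.descendants {V : Type*} (D : Digraph V) (X : Set V) : Set V :=
  {w | ∃ x ∈ X, Relation.ReflTransGen D.Adj x w}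

/-- `p` is a path from the node set `X` to the node set `Y`: a sequence of distinct nodes, the
first in `X` and the last in `Y`, in which successive nodes are joined by an edge of either
direction. -/
structure Digraph.IsPath {V : Type*} (D : Digraph V) (X Y : Set V) (p : List V) : Prop where
  nodup : p.Nodup
  chain : p.IsChain fun a b => D.Adj a b ∨ D.Adj b a
  head : ∃ x ∈ X, p.head? = some x
  last : ∃ y ∈ Y, p.getLast? = some y

/-- A path is proper with respect to `X` if only its first node is in `X`. -/
def IsProperPath {V : Type*} (X : Set V) (p : List V) : Prop :=
  ∀ v ∈ p.tail, v ∉ X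

/-- A path in a DAG is a back-door path if it does not begin with an edge out of its
first node. -/
def Digraph.IsBackDoorPath {V : Type*} (D : Digraph V) (p : List V) : Prop :=
  ∀ a b, [a, b] <+: p → ¬ D.Adj a b

/-- The path `p` is d-connecting given `C`: every non-collider on `p` lies outside `C` and every
collider on `p` has a descendant in `C`. Here `b` ranges over the non-endpoints of `p`, with
neighbours `a` and `c` on `p`. -/
def Digraph.IsDConnecting {V : Type*} (D : Digraph V) (C : Set V) (p : List V) : Prop :=
  ∀ a b c, [a, b, c] <:+: p →
    (¬ (D.Adj a b ∧ D.Adj c b) → b ∉ C) ∧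
    (D.Adj a b ∧ D.Adj c b → (D.descendants {b} ∩ C).Nonempty)

/-- `C` blocks the path `p`. -/
def Digraph.Blocks {V : Type*} (D : Digraph V) (C : Set V) (p : List V) : Prop :=
  ¬ D.IsDConnecting C p

/-- The conditional back-door criterion relative to `(X, Y, Z)`. -/
structure Digraph.ConditionalBackDoorCriterion {V : Type*} (D : Digraph V)
    (X Y Z S : Set V) : Prop where
  disjoint_descendants : Disjoint S (D.descendants X)
  blocks : ∀ p, D.IsPath X Y p → IsProperPath X p → D.IsBackDoorPath p → D.Blocks (S ∪ Z) p

/-! ### Densities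

The random variable at the node `i` takes values in `E i`, and densities are taken with respect
to products of reference measures on the spaces `E i` (Lebesgue measure, counting measure, ...). -/

/-- The marginal density `f(a)` of the variables in `A`, for a joint density `f` with respect
to the product of the measures `μ i`: all other variables are integrated out. The value depends
on `v` only through its coordinates in `A`. -/
noncomputable def marginalDensity {V : Type*} [Fintype V] [DecidableEq V] {E : V → Type*}
    [∀ i, MeasurableSpace (E i)] (μ : ∀ i, Measure (E i)) (f : (∀ i, E i) → ℝ≥0∞)
    (A : Finset V) (v : ∀ i, E i) : ℝ≥0∞ :=
  lmarginal μ Aᶜ f v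

/-- The conditional density `f(b | a) = f(b, a) / f(a)`, where `b` and `a` are the coordinates of
`v` in `B` and `A`. -/
noncomputable def conditionalDensity {V : Type*} [Fintype V] [DecidableEq V] {E : V → Type*}
    [∀ i, MeasurableSpace (E i)] (μ : ∀ i, Measure (E i)) (f : (∀ i, E i) → ℝ≥0∞)
    (B A : Finset V) (v : ∀ i, E i) : ℝ≥0∞ :=
  marginalDensity μ f (B ∪ A) v / marginalDensity μ f A v

/-- The reference measures after the intervention `do(x)`: each variable in `X` is
concentrated at its prescribed value, each other variable keeps its reference measure. -/
noncomputable def doMeasure {V : Type*} [DecidableEq V] {E : V → Type*}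
    [∀ i, MeasurableSpace (E i)] (ν : ∀ i, Measure (E i)) (X : Finset V)
    (x : (i : X) → E i) (i : V) : Measure (E i) :=
  if h : i ∈ X then Measure.dirac (x ⟨i, h⟩) else ν i

/-- The truncated factorization
`∏_{i ∉ X} f(v_i | pa(v_i)) · 1(v_X = x)` for an observational density `f`. -/
noncomputable def truncatedFactorization {V : Type*} [Fintype V] [DecidableEq V] {E : V → Type*}
    [∀ i, MeasurableSpace (E i)] (D : Digraph V) (ν : ∀ i, Measure (E i))
    (f : (∀ i, E i) → ℝ≥0∞) (X : Finset V) (x : (i : X) → E i) : (∀ i, E i) → ℝ≥0∞ :=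
  Set.indicator {v | ∀ i : X, v i = x i}
    fun v => ∏ i ∈ Xᶜ, conditionalDensity ν f {i} (D.parents i) v

/-- A family of interventional densities: `F X x v` is `f(v | do(x))`, where `x` assigns values
to the variables in `X`. It includes the case where `X` is empty. -/
abbrev InterventionalFamily {V : Type*} (E : V → Type*) :=
  (X : Finset V) → ((i : X) → E i) → (∀ i, E i) → ℝ≥0∞

/-- The observational density `f(v)`, i.e. the member of the family for the empty intervention. -/
def InterventionalFamily.obs {V : Type*} {E : V → Type*} (F : InterventionalFamily E) :
    (∀ i, E i) → ℝ≥0∞ :=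
  F ∅ fun i => (Finset.notMem_empty _ i.2).elim

/-- The causal DAG `D` is a causal Bayesian network compatible with the family `F`: the
observational density is a positive probability density and every `f(v | do(x))` is
given by the truncated factorization. For `X = ∅` the latter says that the observational density
is Markov compatible with `D`. Equalities between densities are understood almost everywhere:
in the intervention value `x` with respect to the reference measure on the variables in `X`, and
in `v` with respect to the reference measure after `do(x)`. -/
structure IsCompatibleFamily {V : Type*} [Fintype V] [DecidableEq V] {E : V → Type*}
    [∀ i, MeasurableSpace (E i)] (D : Digraph V) (ν : ∀ i, Measure (E i))
    (F : InterventionalFamily E) : Prop where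
  measurable_obs : Measurable F.obs
  lintegral_obs : ∫⁻ v, F.obs v ∂Measure.pi ν = 1
  pos_obs : ∀ᵐ v ∂Measure.pi ν, 0 < F.obs v
  truncated : ∀ X : Finset V, ∀ᵐ x ∂Measure.pi (fun i : X => ν i),
    F X x =ᵐ[Measure.pi (doMeasure ν X x)] truncatedFactorization D ν F.obs X x

/-- `S` is a conditional adjustment set relative to `(X, Y, Z)` in the causal DAG `D`: for all
densities consistent with `D`, over arbitrary state spaces and reference measures,
`f(y | do(x), z)` equals `f(y | x, z)` if `S = ∅`, and `∫ f(y | x, z, s) f(s | z) ds` otherwise.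
In the equation, `v` carries the values `y`, `z`; its coordinates in `X` are those of `x` almost
everywhere, as the measure after `do(x)` is concentrated at `x` there. -/
def IsConditionalAdjustmentSet {V : Type u} [Fintype V] [DecidableEq V]
    (D : Digraph V) (X Y Z S : Finset V) : Prop :=
  ∀ (E : V → Type w) [∀ i, MeasurableSpace (E i)] [∀ i, MeasurableSingletonClass (E i)]
    (ν : ∀ i, Measure (E i)) [∀ i, SigmaFinite (ν i)] (F : InterventionalFamily E),
    IsCompatibleFamily D ν F →
    ∀ᵐ x ∂Measure.pi (fun i : X => ν i), ∀ᵐ v ∂Measure.pi (doMeasure ν X x),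
      conditionalDensity (doMeasure ν X x) (F X x) Y Z v =
        if S = ∅ then conditionalDensity ν F.obs Y (X ∪ Z) v
        else lmarginal ν S (fun v' => conditionalDensity ν F.obs Y (X ∪ Z ∪ S) v' *
          conditionalDensity ν F.obs S Z v') v

/-! Write W = S ∪ Z. By the truncated factorization, intervening on X deletes the kernels of the
nodes of X from the product of all kernels f(v_i | pa(v_i)). Two facts about this shortened product
give the formula.

Invariance (`lmarginal_prod_nodeKernel_compl`): the marginal over a set of non-descendants of X,
such as Z or W, is unchanged. All descendants of X can be integrated out, children before parents,
with each kernel integrating to one; what remains is the same product with or without the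
intervention.

Back-door identity (`marginalDensity_mul_lmarginal_prod_nodeKernel`): f(y | do(x), w) = f(y | x, w).
First restrict to the ancestors A of X ∪ Y ∪ W. Let R be the nodes of A outside W that an active
walk reaches from X once the edges out of X are deleted. Blocking of the back-door paths keeps Y out
of R, and each kernel in A either depends on R ∪ W only, or belongs to a node outside X and involves
no variable of R \ X (`exists_separating_set`). Hence the marginals split: f(x,y,w) = a·b_Y and
f(x,w) = a·b, while after the intervention they are a'·b_Y and a'·b, because every kernel of X sits
in the first factor. Cross-multiplying gives the identity without division.

The integrand f(y | x,z,s) f(s | z) then equals f(y,s,z | do(x)) / f(z). Integrating over s and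
using f(z) = f(z | do(x)) finishes the proof. Walks are used because they concatenate freely;
`IsActiveWalk.exists_nodup` converts them back to paths. -/

/-! ### Active walks and their reduction to active paths -/

namespace Digraph

variable {V : Type*} {D : Digraph V} {C : Set V}

theorem IsDAG.asymm (hD : D.IsDAG) {a b : V} (h : D.Adj a b) : ¬ D.Adj b a :=
  fun h' => hD a ((Relation.TransGen.single h).tail h')

/-- A walk with consecutive nodes `a, b, c` can be passed at `b` given `C`. -/
def IsOpenAt (D : Digraph V) (C : Set V) (a b c : V) : Prop :=
  (¬ (D.Adj a b ∧ D.Adj c b) → b ∉ C) ∧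
    (D.Adj a b ∧ D.Adj c b → (D.descendants {b} ∩ C).Nonempty)

/-- A walk, possibly with repeated nodes, that is d-connecting given `C`. -/
inductive IsActiveWalk (D : Digraph V) (C : Set V) : List V → Prop
  | single (a : V) : IsActiveWalk D C [a]
  | pair {a b : V} : (D.Adj a b ∨ D.Adj b a) → IsActiveWalk D C [a, b]
  | cons {a b c : V} {l : List V} : (D.Adj a b ∨ D.Adj b a) → D.IsOpenAt C a b c →
      IsActiveWalk D C (b :: c :: l) → IsActiveWalk D C (a :: b :: c :: l)

theorem IsActiveWalk.isChain {p : List V} (h : D.IsActiveWalk C p) :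
    p.IsChain fun a b => D.Adj a b ∨ D.Adj b a := by
  induction h with
  | single => simp
  | pair h => simpa using h
  | cons h _ _ ih => exact List.IsChain.cons_cons h ih

theorem IsActiveWalk.isOpenAt {p : List V} (h : D.IsActiveWalk C p) {a b c : V}
    (hp : [a, b, c] <:+: p) : D.IsOpenAt C a b c := by
  induction h with
  | single => simpa using hp.length_le
  | pair h => simpa using hp.length_le
  | cons h h' _ ih =>
    rcases List.infix_cons_iff.1 hp with hp | hp
    · simp only [List.cons_prefix_cons, List.nil_prefix, and_true] at hp
      obtain ⟨rfl, rfl, rfl⟩ := hp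
      exact h'
    · exact ih hp

theorem isOpenAt_comm {a b c : V} : D.IsOpenAt C a b c ↔ D.IsOpenAt C c b a := by
  unfold IsOpenAt
  rw [and_comm (a := D.Adj a b)]

theorem isActiveWalk_cons_cons_iff {a b : V} {l : List V} :
    D.IsActiveWalk C (a :: b :: l) ↔ (D.Adj a b ∨ D.Adj b a) ∧
      (∀ c, l.head? = some c → D.IsOpenAt C a b c) ∧ D.IsActiveWalk C (b :: l) := by
  constructor
  · intro h
    cases h with
    | pair h => exact ⟨h, by simp, .single _⟩
    | cons h h' h'' => exact ⟨h, by simpa using h', h''⟩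
  · rintro ⟨h, h', h''⟩
    cases l with
    | nil => exact .pair h
    | cons c l => exact .cons h (h' c rfl) h''

/-- An active walk through `v` consists of two active walks that fit together at `v`. -/
theorem isActiveWalk_append_cons_iff {v : V} {l₁ l₂ : List V} :
    D.IsActiveWalk C (l₁ ++ v :: l₂) ↔ D.IsActiveWalk C (l₁ ++ [v]) ∧ D.IsActiveWalk C (v :: l₂) ∧
      ∀ a c, l₁.getLast? = some a → l₂.head? = some c → D.IsOpenAt C a v c := by
  induction l₁ with
  | nil => simpa using fun _ => IsActiveWalk.single v
  | cons a l ih =>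
    cases l with
    | nil =>
      simp only [List.cons_append, List.nil_append, isActiveWalk_cons_cons_iff]
      have := IsActiveWalk.single (D := D) (C := C) v
      simp only [List.getLast?_singleton, Option.some.injEq, this, and_true]
      constructor
      · rintro ⟨h, h', h''⟩
        exact ⟨⟨h, by simp⟩, h'', fun _ c ha hc => ha ▸ h' c hc⟩
      · rintro ⟨⟨h, _⟩, h'', h'⟩
        exact ⟨h, fun c => h' a c rfl, h''⟩
    | cons b l =>
      simp only [List.cons_append] at ih ⊢
      rw [isActiveWalk_cons_cons_iff, ih, isActiveWalk_cons_cons_iff, List.getLast?_cons_cons]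
      have : (l ++ v :: l₂).head? = (l ++ [v]).head? := by cases l <;> simp
      rw [this]
      tauto

theorem subset_descendants (X : Set V) : X ⊆ D.descendants X :=
  fun x hx => ⟨x, hx, .refl⟩

theorem nonempty_descendants_inter_iff {a : V} :
    (D.descendants {a} ∩ C).Nonempty ↔ ∃ c ∈ C, Relation.ReflTransGen D.Adj a c := by
  constructor
  · rintro ⟨c, ⟨x, rfl, h⟩, hc⟩
    exact ⟨c, hc, h⟩
  · rintro ⟨c, hc, h⟩
    exact ⟨c, ⟨a, rfl, h⟩, hc⟩

/-- An active walk that starts along an edge out of `a` is directed, unless `a` has a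
descendant in `C`. -/
theorem IsActiveWalk.transGen_of_adj {p : List V} (h : D.IsActiveWalk C p) :
    ∀ {a b z : V} {l : List V}, p = a :: b :: l → D.Adj a b → p.getLast? = some z →
      (D.descendants {a} ∩ C).Nonempty ∨ Relation.TransGen D.Adj a z := by
  simp only [nonempty_descendants_inter_iff]
  induction h with
  | single => simp
  | @pair a b h =>
    rintro _ _ z _ ⟨⟩ hab hz
    obtain rfl : b = z := by simpa using hz
    exact .inr (.single hab)
  | @cons a b c l h h' _ ih =>
    rintro _ _ z _ ⟨⟩ hab hz
    by_cases hbc : D.Adj c b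
    · obtain ⟨w, hw, hbw⟩ := nonempty_descendants_inter_iff.1 (h'.2 ⟨hab, hbc⟩)
      exact .inl ⟨w, hw, .head hab hbw⟩
    · rename_i hw
      have hbc : D.Adj b c := by
        have := hw.isChain
        simp only [List.isChain_cons_cons] at this
        tauto
      rcases ih rfl hbc (by simpa using hz) with ⟨w, hw, hbw⟩ | hbz
      · exact .inl ⟨w, hw, .head hab hbw⟩
      · exact .inr (.head hab hbz)

/-- A closed loop can be cut out of an active walk. -/
theorem IsActiveWalk.cut (hD : D.IsDAG) {l₁ l₂ l₃ : List V} {v : V}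
    (h : D.IsActiveWalk C (l₁ ++ v :: (l₂ ++ v :: l₃))) : D.IsActiveWalk C (l₁ ++ v :: l₃) := by
  obtain ⟨h₁, h₂, h₃⟩ := isActiveWalk_append_cons_iff.1 h
  rw [← List.cons_append] at h₂
  obtain ⟨h₄, h₅, h₆⟩ := isActiveWalk_append_cons_iff.1 h₂
  refine isActiveWalk_append_cons_iff.2 ⟨h₁, h₅, fun a c ha hc => ?_⟩
  cases l₂ with
  | nil =>
    have := h₄.isChain
    simp only [List.singleton_append, List.isChain_pair, or_self] at this
    exact (hD v (.single this)).elim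
  | cons b l₂ =>
    have hb := h₃ a b ha (by simp)
    obtain ⟨d, hd⟩ : ∃ d, (v :: b :: l₂).getLast? = some d :=
      ⟨_, List.getLast?_eq_some_getLast (by simp)⟩
    have hd' := h₆ d c hd hc
    constructor
    -- If `a` points to `v`, then `c` does not, so the second visit passes `v` as a non-collider;
    -- otherwise the first visit does.
    · intro hac hv
      by_cases hav : D.Adj a v
      · exact hd'.1 (fun h => hac ⟨hav, h.2⟩) hv
      · exact hb.1 (fun h => hav h.1) hv
    · rintro ⟨hav, hcv⟩
      by_cases hbv : D.Adj b v
      · exact hb.2 ⟨hav, hbv⟩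
      · have hvb : D.Adj v b := by
          have := h₄.isChain
          simp only [List.cons_append, List.isChain_cons_cons] at this
          tauto
        -- The loop leaves `v` along an outgoing edge and returns to `v`; it cannot be directed, so
        -- `v` has a descendant in `C`.
        refine (h₄.transGen_of_adj List.cons_append hvb
          (z := v) (by rw [List.getLast?_concat])).resolve_right (hD v)

/-- If there is an active walk between two nodes then there is an active path. -/
theorem IsActiveWalk.exists_nodup (hD : D.IsDAG) {x y : V} {p : List V}
    (h : D.IsActiveWalk C p) (hx : p.head? = some x) (hy : p.getLast? = some y) :
    ∃ q : List V, q.Nodup ∧ D.IsActiveWalk C q ∧ q.head? = some x ∧ q.getLast? = some y := by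
  induction hn : p.length using Nat.strong_induction_on generalizing p with
  | _ n ih =>
    by_cases hp : p.Nodup
    · exact ⟨p, hp, h, hx, hy⟩
    obtain ⟨v, hv⟩ := List.exists_duplicate_iff_not_nodup.2 hp
    obtain ⟨l₁, l₂, l₃, rfl⟩ : ∃ l₁ l₂ l₃, p = l₁ ++ v :: (l₂ ++ v :: l₃) := by
      obtain ⟨r₁, r₂, rfl, h₁, h₂⟩ := List.cons_sublist_iff.1 (List.duplicate_iff_sublist.1 hv)
      obtain ⟨l₁, l₂, rfl⟩ := List.append_of_mem h₁
      obtain ⟨l₃, l₄, rfl⟩ := List.append_of_mem (List.singleton_sublist.1 h₂)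
      exact ⟨l₁, l₂ ++ l₃, l₄, by simp⟩
    refine ih _ ?_ (h.cut hD) ?_ ?_ rfl
    · simp at hn ⊢
      omega
    · cases l₁ <;> simpa using hx
    · simpa [List.getLast?_append, List.getLast?_cons] using hy

end Digraph

/-! ### Separating sets from reachability by active walks -/

namespace Digraph

variable {V : Type*} {D : Digraph V} {X Y C : Set V}

/-- The ancestors of the node set `A`; every node is an ancestor of itself. -/
def ancestors (D : Digraph V) (A : Set V) : Set V :=
  {v | ∃ a ∈ A, Relation.ReflTransGen D.Adj v a}

theorem subset_ancestors (A : Set V) : A ⊆ D.ancestors A :=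
  fun a ha => ⟨a, ha, .refl⟩

theorem mem_ancestors_of_adj {A : Set V} {a b : V} (hb : b ∈ D.ancestors A) (h : D.Adj a b) :
    a ∈ D.ancestors A := by
  obtain ⟨c, hc, hbc⟩ := hb
  exact ⟨c, hc, .head h hbc⟩

/-- The graph in which all edges out of nodes of `X` are deleted. -/
def deleteOut (D : Digraph V) (X : Set V) : Digraph V where
  Adj a b := D.Adj a b ∧ a ∉ X

theorem IsDAG.deleteOut (hD : D.IsDAG) (X : Set V) : (D.deleteOut X).IsDAG :=
  fun v h => hD v (Relation.TransGen.mono (fun _ _ h => h.1) _ _ h)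

theorem reflTransGen_deleteOut {a b : V}
    (h : Relation.ReflTransGen (D.deleteOut X).Adj a b) : Relation.ReflTransGen D.Adj a b :=
  Relation.ReflTransGen.mono (fun _ _ h => h.1) _ _ h

/-- A directed path into `A` may be stopped at its first node in `X`, before it uses a deleted edge.
-/
theorem ancestors_deleteOut {A : Set V} (hX : X ⊆ A) :
    (D.deleteOut X).ancestors A = D.ancestors A := by
  ext v
  constructor
  · rintro ⟨a, ha, h⟩
    exact ⟨a, ha, reflTransGen_deleteOut h⟩
  · rintro ⟨a, ha, h⟩
    induction h using Relation.ReflTransGen.head_induction_on with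
    | refl => exact subset_ancestors A ha
    | @head b c hbc _ ih =>
      by_cases hb : b ∈ X
      · exact subset_ancestors A (hX hb)
      · exact mem_ancestors_of_adj ih ⟨hbc, hb⟩

/-- There is an active walk from a node of `X` to `v`; it is listed in reverse order. -/
def IsReachable (D : Digraph V) (C X : Set V) (v : V) : Prop :=
  ∃ l, D.IsActiveWalk C (v :: l) ∧ ∃ x ∈ X, (v :: l).getLast? = some x

theorem IsReachable.of_mem {v : V} (hv : v ∈ X) : D.IsReachable C X v :=
  ⟨[], .single v, v, hv, rfl⟩

theorem IsActiveWalk.cons_of_adj (hD : D.IsDAG) {a b : V} {l : List V}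
    (h : D.IsActiveWalk C (a :: l)) (ha : a ∉ C) (hab : D.Adj a b) :
    D.IsActiveWalk C (b :: a :: l) :=
  isActiveWalk_cons_cons_iff.2 ⟨.inr hab,
    fun _ _ => ⟨fun _ => ha, fun h => (hD.asymm hab h.1).elim⟩, h⟩

/-- The walk continues along the directed path: each node it leaves by an outgoing edge is a
non-collider, and lies outside `C` as a descendant of `a`. -/
theorem IsReachable.of_reflTransGen (hD : D.IsDAG) {a b : V} (h : D.IsReachable C X a)
    (ha : ¬ (D.descendants {a} ∩ C).Nonempty) (hab : Relation.ReflTransGen D.Adj a b) :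
    D.IsReachable C X b := by
  rw [nonempty_descendants_inter_iff] at ha
  induction hab with
  | refl => exact h
  | @tail b c hab hbc ih =>
    obtain ⟨l, hl, x, hx, hlx⟩ := ih
    exact ⟨b :: l, hl.cons_of_adj hD (fun hb => ha ⟨b, hb, hab⟩) hbc, x, hx, by simpa using hlx⟩

theorem isActiveWalk_cons_of_forall_adj (hD : D.IsDAG) {a b : V} {l : List V}
    (h : D.IsActiveWalk C (a :: l)) (ha : a ∉ C) (hl : ∀ c, l.head? = some c → D.Adj a c)
    (hab : D.Adj a b ∨ D.Adj b a) : D.IsActiveWalk C (b :: a :: l) :=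
  isActiveWalk_cons_cons_iff.2 ⟨hab.symm,
    fun c hc => ⟨fun _ => ha, fun h => (hD.asymm (hl c hc) h.2).elim⟩, h⟩

/-- The directed path itself serves. The last clause makes `a` a non-collider however the walk is
prolonged beyond `a`. -/
theorem exists_isActiveWalk_of_reflTransGen (hD : D.IsDAG) {a x : V}
    (ha : ¬ (D.descendants {a} ∩ C).Nonempty) (hax : Relation.ReflTransGen D.Adj a x) :
    ∃ l, D.IsActiveWalk C (a :: l) ∧ (a :: l).getLast? = some x ∧
      ∀ c, l.head? = some c → D.Adj a c := by
  rw [nonempty_descendants_inter_iff] at ha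
  induction hax using Relation.ReflTransGen.head_induction_on with
  | refl => exact ⟨[], .single x, rfl, by simp⟩
  | @head a c hac hcx ih =>
    obtain ⟨l, hl, hly, h⟩ := ih fun ⟨w, hw, hcw⟩ => ha ⟨w, hw, .head hac hcw⟩
    have hc : c ∉ C := fun h => ha ⟨c, h, .single hac⟩
    exact ⟨c :: l, isActiveWalk_cons_of_forall_adj hD hl hc h (.inr hac), by simpa using hly,
      by simpa using hac⟩

/-- Reachability propagates along the edges between ancestors of `X ∪ Y ∪ C` outside `C`. -/
theorem IsReachable.of_adj (hD : D.IsDAG) {a b : V} (h : D.IsReachable C X a) (ha : a ∉ C)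
    (hY : ∀ y ∈ Y, ¬ D.IsReachable C X y) (haA : a ∈ D.ancestors (X ∪ Y ∪ C))
    (hab : D.Adj a b ∨ D.Adj b a) : D.IsReachable C X b := by
  -- A node outside `C` with a descendant in `C` can be passed in any direction. Otherwise `a` has a
  -- directed path to `X` or `Y`: the former, run backwards, replaces the walk to `a`, and the
  -- latter would make `Y` reachable.
  by_cases hC : (D.descendants {a} ∩ C).Nonempty
  · obtain ⟨l, hl, x, hx, hlx⟩ := h
    exact ⟨a :: l, isActiveWalk_cons_cons_iff.2 ⟨hab.symm, fun c _ => ⟨fun _ => ha, fun _ => hC⟩,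
      hl⟩, x, hx, by simpa using hlx⟩
  · obtain ⟨w, (hw | hw) | hw, haw⟩ := haA
    · obtain ⟨l, hl, hlw, hl'⟩ := exists_isActiveWalk_of_reflTransGen hD hC haw
      exact ⟨a :: l, isActiveWalk_cons_of_forall_adj hD hl ha hl' hab, w, hw, by simpa using hlw⟩
    · exact (hY w hw (h.of_reflTransGen hD hC haw)).elim
    · exact (hC (nonempty_descendants_inter_iff.2 ⟨w, hw, haw⟩)).elim

theorem IsReachable.of_collider (hD : D.IsDAG) {a b c : V} (h : D.IsReachable C X a)
    (ha : a ∉ C) (hc : c ∈ C) (hac : D.Adj a c) (hbc : D.Adj b c) : D.IsReachable C X b := by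
  obtain ⟨l, hl, x, hx, hlx⟩ := h
  refine ⟨c :: a :: l, isActiveWalk_cons_cons_iff.2 ⟨.inl hbc, ?_, hl.cons_of_adj hD ha hac⟩,
    x, hx, by simpa using hlx⟩
  rintro d hd
  obtain rfl : a = d := by simpa using hd
  exact ⟨fun h => (h ⟨hbc, hac⟩).elim,
    fun _ => nonempty_descendants_inter_iff.2 ⟨c, hc, .refl⟩⟩

/-- Families of ancestors of `X ∪ Y ∪ C` are reachable either completely or not at all, up to
nodes in `C`. -/
theorem IsReachable.of_family (hD : D.IsDAG) {a b i : V} (h : D.IsReachable C X a) (ha : a ∉ C)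
    (hY : ∀ y ∈ Y, ¬ D.IsReachable C X y) (hi : i ∈ D.ancestors (X ∪ Y ∪ C))
    (hai : a = i ∨ D.Adj a i) (hbi : b = i ∨ D.Adj b i) : D.IsReachable C X b := by
  rcases hai with rfl | hai
  · rcases hbi with rfl | hbi
    · exact h
    · exact h.of_adj hD ha hY hi (.inr hbi)
  · have hi' := h.of_adj hD ha hY (mem_ancestors_of_adj hi hai) (.inl hai)
    rcases hbi with rfl | hbi
    · exact hi'
    · by_cases hiC : i ∈ C
      · exact h.of_collider hD ha hiC hai hbi
      · exact hi'.of_adj hD hiC hY hi (.inr hbi)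

/-- If `C` blocks all proper back-door paths from `X` to `Y`, then no node of `Y` is reachable
from `X` once the edges out of `X` are deleted. -/
theorem not_isReachable_deleteOut (hD : D.IsDAG) (hXY : Disjoint X Y) (hXC : Disjoint X C)
    (hC : ∀ p, D.IsPath X Y p → IsProperPath X p → D.IsBackDoorPath p → D.Blocks C p) :
    ∀ y ∈ Y, ¬ (D.deleteOut X).IsReachable C X y := by
  rintro y hy ⟨l, hl, x, hx, hlx⟩
  obtain ⟨q, hq, hqa, hqy, hqx⟩ := hl.exists_nodup (hD.deleteOut X) rfl hlx
  have hchain : q.reverse.IsChain fun a b => (D.deleteOut X).Adj a b ∨ (D.deleteOut X).Adj b a := by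
    rw [List.isChain_reverse]
    exact hqa.isChain.imp fun _ _ h => h.symm
  have hopen : ∀ a b c, [a, b, c] <:+: q.reverse → (D.deleteOut X).IsOpenAt C a b c := by
    intro a b c h
    refine isOpenAt_comm.1 (hqa.isOpenAt ?_)
    rw [← List.reverse_infix]
    simpa using h
  have hpx : q.reverse.head? = some x := by simpa using hqx
  have hpy : q.reverse.getLast? = some y := by simpa using hqy
  have hpn : q.reverse.Nodup := by simpa using hq
  generalize q.reverse = p at *
  -- With its outgoing edges deleted, an interior node of `X` would be a collider whose only
  -- descendant is itself, which is not in `C`.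
  have hmid : ∀ a b c, [a, b, c] <:+: p → b ∉ X := by
    intro a b c h hb
    have h' := hchain.infix h
    simp only [List.isChain_cons_cons, deleteOut, hb, not_true, and_false, or_false,
      false_or] at h'
    obtain ⟨d, hd, hbd⟩ := nonempty_descendants_inter_iff.1
      ((hopen a b c h).2 ⟨h'.1, h'.2.1⟩)
    rcases Relation.ReflTransGen.cases_head hbd with rfl | ⟨e, he, -⟩
    · exact hXC.ne_of_mem hb hd rfl
    · exact he.2 hb
  -- By acyclicity a surviving edge has only one orientation, so colliders on the path agree in both
  -- graphs.
  have hadj : ∀ a b, (D.deleteOut X).Adj a b ∨ (D.deleteOut X).Adj b a →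
      D.Adj a b → (D.deleteOut X).Adj a b := by
    rintro a b (h | h) hab
    · exact h
    · exact (hD.asymm h.1 hab).elim
  refine hC p ⟨hpn, hchain.imp fun _ _ h => h.imp And.left And.left, ⟨x, hx, hpx⟩, y, hy, hpy⟩
    ?_ ?_ ?_
  · cases p with
    | nil => simp at hpx
    | cons a p =>
      intro v hv hvX
      obtain ⟨s, t, rfl⟩ := List.append_of_mem hv
      cases t with
      | nil =>
        rw [← List.cons_append, List.getLast?_concat] at hpy
        exact hXY.ne_of_mem hvX hy (by simpa using hpy)
      | cons c t =>
        obtain ⟨s', b, hs⟩ : ∃ s' b, a :: s = s' ++ [b] :=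
          ⟨_, _, (List.dropLast_append_getLast (by simp)).symm⟩
        refine hmid b v c ⟨s', t, ?_⟩ hvX
        rw [← List.cons_append, hs]
        simp
  · intro a b hab hadj'
    obtain rfl : a = x := by
      obtain ⟨t, rfl⟩ := hab
      simpa using hpx
    have h' := hchain.infix hab.isInfix
    simp only [List.isChain_cons_cons] at h'
    exact (hadj a b h'.1 hadj').2 hx
  · intro a b c h
    have h' := hchain.infix h
    simp only [List.isChain_cons_cons] at h'
    have hiff : D.Adj a b ∧ D.Adj c b ↔ (D.deleteOut X).Adj a b ∧ (D.deleteOut X).Adj c b :=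
      ⟨fun h => ⟨hadj _ _ h'.1 h.1, hadj _ _ h'.2.1.symm h.2⟩, fun h => ⟨h.1.1, h.2.1⟩⟩
    refine ⟨fun hn => (hopen a b c h).1 (hiff.not.1 hn), fun hn => ?_⟩
    obtain ⟨d, hd, hbd⟩ := nonempty_descendants_inter_iff.1 ((hopen a b c h).2 (hiff.1 hn))
    exact nonempty_descendants_inter_iff.2 ⟨d, hd, reflTransGen_deleteOut hbd⟩

/-- If `C` blocks all proper back-door paths from `X` to `Y`, then there is a node set `R` that
separates `X` from `Y`: every family `{i} ∪ pa(i)` within the ancestors of `X ∪ Y ∪ C` lies in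
`R ∪ C`, or it belongs to a node outside `X` and meets `R` only in `X`. -/
theorem exists_separating_set (hD : D.IsDAG) (hXY : Disjoint X Y) (hXC : Disjoint X C)
    (hC : ∀ p, D.IsPath X Y p → IsProperPath X p → D.IsBackDoorPath p → D.Blocks C p) :
    ∃ R : Set V, X ⊆ R ∧ Disjoint R C ∧ Disjoint R Y ∧ R ⊆ D.ancestors (X ∪ Y ∪ C) ∧
      ∀ i ∈ D.ancestors (X ∪ Y ∪ C),
        (∀ j, j = i ∨ D.Adj j i → j ∈ R ∪ C) ∨
          i ∉ X ∧ ∀ j, j = i ∨ D.Adj j i → j ∈ R → j ∈ X := by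
  have hA : (D.deleteOut X).ancestors (X ∪ Y ∪ C) = D.ancestors (X ∪ Y ∪ C) :=
    ancestors_deleteOut (Set.subset_union_left.trans Set.subset_union_left)
  have hY := not_isReachable_deleteOut hD hXY hXC hC
  refine ⟨{v | v ∈ D.ancestors (X ∪ Y ∪ C) ∧ v ∉ C ∧ (D.deleteOut X).IsReachable C X v},
    fun x hx => ⟨subset_ancestors _ (.inl (.inl hx)), hXC.notMem_of_mem_left hx, .of_mem hx⟩,
    Set.disjoint_left.2 fun v hv => hv.2.1, Set.disjoint_left.2 fun v hv hvY => hY v hvY hv.2.2,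
    fun v hv => hv.1, fun i hi => ?_⟩
  by_cases h : ∃ a, (a = i ∨ (D.deleteOut X).Adj a i) ∧ a ∉ C ∧ (D.deleteOut X).IsReachable C X a
  · obtain ⟨a, hai, haC, ha⟩ := h
    left
    intro j hj
    have hjA : j ∈ D.ancestors (X ∪ Y ∪ C) := by
      rcases hj with rfl | hj
      exacts [hi, mem_ancestors_of_adj hi hj]
    by_cases hjC : j ∈ C
    · exact .inr hjC
    · refine .inl ⟨hjA, hjC, ?_⟩
      by_cases hjX : j ∈ X
      · exact .of_mem hjX
      · exact ha.of_family (hD.deleteOut X) haC hY (hA ▸ hi) hai (hj.imp_right fun hj => ⟨hj, hjX⟩)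
  -- Reachability ignores edges out of `X`, so a parent in `X` belongs to `R` without making the
  -- family reachable.
  · right
    refine ⟨fun hiX => h ⟨i, .inl rfl, hXC.notMem_of_mem_left hiX, .of_mem hiX⟩,
      fun j hj hjR => by_contra fun hjX => ?_⟩
    exact h ⟨j, hj.imp_right fun hj => ⟨hj, hjX⟩, hjR.2⟩

end Digraph

/-! ### Iterated integrals and null sets -/

section Marginal

variable {V : Type*} [DecidableEq V] {E : V → Type*} [∀ i, MeasurableSpace (E i)]

theorem DependsOn.lmarginal {μ : ∀ i, Measure (E i)} {g : (∀ i, E i) → ℝ≥0∞} {s : Set V}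
    (hg : DependsOn g s) (T : Finset V) : DependsOn (lmarginal μ T g) (s \ T) := by
  intro v w h
  refine lintegral_congr fun y => hg fun i hi => ?_
  simp only [Function.updateFinset_def]
  split_ifs with hT
  · rfl
  · exact h i ⟨hi, hT⟩

theorem dependsOn_lmarginal (μ : ∀ i, Measure (E i)) (g : (∀ i, E i) → ℝ≥0∞) (T : Finset V) :
    DependsOn (lmarginal μ T g) (T : Set V)ᶜ :=
  fun _ _ h => lmarginal_congr μ g fun i hi => h i (by simpa using hi)

theorem DependsOn.finset_prod {ι κ : Type*} {α : ι → Type*} {f : κ → (∀ i, α i) → ℝ≥0∞}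
    {s : Set ι} {K : Finset κ} (hf : ∀ i ∈ K, DependsOn (f i) s) :
    DependsOn (fun v => ∏ i ∈ K, f i v) s :=
  fun _ _ h => Finset.prod_congr rfl fun i hi => hf i hi h

omit [∀ i, MeasurableSpace (E i)] in
theorem DependsOn.apply_updateFinset {g : (∀ i, E i) → ℝ≥0∞} {s : Set V} (hg : DependsOn g s)
    {T : Finset V} (hT : Disjoint s T) (v : ∀ i, E i) (y : ∀ i : T, E i) :
    g (Function.updateFinset v T y) = g v :=
  hg fun i hi => by
    have : i ∉ T := fun h => hT.ne_of_mem hi h rfl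
    simp [Function.updateFinset_def, this]

/-- A factor that does not depend on the integrated variables can be taken out. -/
theorem lmarginal_mul_left {μ : ∀ i, Measure (E i)} {g h : (∀ i, E i) → ℝ≥0∞} {s : Set V}
    {T : Finset V} (hg : DependsOn g s) (hT : Disjoint s T) (hh : Measurable h) :
    lmarginal μ T (fun v => g v * h v) = fun v => g v * lmarginal μ T h v := by
  ext v
  simp only [lmarginal, hg.apply_updateFinset hT]
  exact lintegral_const_mul _ (hh.comp measurable_updateFinset)

theorem lmarginal_mul_right {μ : ∀ i, Measure (E i)} {g h : (∀ i, E i) → ℝ≥0∞} {s : Set V}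
    {T : Finset V} (hg : DependsOn g s) (hT : Disjoint s T) (hh : Measurable h) :
    lmarginal μ T (fun v => h v * g v) = fun v => lmarginal μ T h v * g v := by
  simpa only [mul_comm] using lmarginal_mul_left (μ := μ) hg hT hh

theorem lmarginal_union_mul {μ : ∀ i, Measure (E i)} [∀ i, SigmaFinite (μ i)]
    {g h : (∀ i, E i) → ℝ≥0∞} {s t : Set V} {S T : Finset V} (hST : Disjoint S T)
    (hg : DependsOn g s) (hsT : Disjoint s T) (hh : DependsOn h t) (htS : Disjoint t S)
    (hgm : Measurable g) (hhm : Measurable h) :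
    lmarginal μ (S ∪ T) (fun v => g v * h v) =
      fun v => lmarginal μ S g v * lmarginal μ T h v := by
  rw [lmarginal_union μ (fun v => g v * h v) (hgm.mul hhm) hST, lmarginal_mul_left hg hsT hhm,
    lmarginal_mul_right (hh.lmarginal T) (htS.mono_left Set.sdiff_subset) hgm]

variable [Fintype V]

theorem lmarginal_lmarginal_compl {μ : ∀ i, Measure (E i)} [∀ i, SigmaFinite (μ i)]
    {g : (∀ i, E i) → ℝ≥0∞} (hg : Measurable g) (A : Finset V) (v : ∀ i, E i) :
    lmarginal μ A (lmarginal μ Aᶜ g) v = ∫⁻ v, g v ∂Measure.pi μ := by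
  rw [← lmarginal_union μ g hg disjoint_compl_right, Finset.union_compl, lmarginal_univ]

/-- Tonelli for the indicator of a measurable null set containing the exceptions: integrating it
over `A` and then over all coordinates again gives zero. -/
theorem ae_ae_updateFinset {μ : ∀ i, Measure (E i)} [∀ i, SigmaFinite (μ i)]
    {P : (∀ i, E i) → Prop} (hP : ∀ᵐ v ∂Measure.pi μ, P v) (A : Finset V) :
    ∀ᵐ v ∂Measure.pi μ, ∀ᵐ y ∂Measure.pi (fun i : A => μ i), P (Function.updateFinset v A y) := by
  obtain ⟨N, hN, hNm, hN0⟩ := exists_measurable_superset_of_null (ae_iff.1 hP)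
  have hg : Measurable (N.indicator (1 : (∀ i, E i) → ℝ≥0∞)) := measurable_one.indicator hNm
  have h0 : lmarginal μ A (N.indicator (1 : (∀ i, E i) → ℝ≥0∞)) =ᵐ[Measure.pi μ] 0 := by
    rcases isEmpty_or_nonempty (∀ i, E i) with h | ⟨⟨v₀⟩⟩
    · exact .of_forall fun v => (h.false v).elim
    rw [← lintegral_eq_zero_iff (hg.lmarginal μ), ← lmarginal_lmarginal_compl (hg.lmarginal μ) A v₀]
    have : lmarginal μ Aᶜ (lmarginal μ A (N.indicator 1)) = fun _ => 0 := by
      ext v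
      have := lmarginal_lmarginal_compl hg (μ := μ) Aᶜ v
      rw [compl_compl] at this
      rw [this, lintegral_indicator_one hNm, hN0]
    rw [this]
    simp [lmarginal]
  filter_upwards [h0] with v hv
  have := (lintegral_eq_zero_iff (hg.comp measurable_updateFinset)).1 hv
  filter_upwards [this] with y hy
  by_contra hPy
  have : Function.updateFinset v A y ∈ N := hN hPy
  simp [this] at hy

theorem lmarginal_congr_ae {μ : ∀ i, Measure (E i)} [∀ i, SigmaFinite (μ i)]
    {g h : (∀ i, E i) → ℝ≥0∞} (hgh : g =ᵐ[Measure.pi μ] h) (A : Finset V) :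
    lmarginal μ A g =ᵐ[Measure.pi μ] lmarginal μ A h := by
  filter_upwards [ae_ae_updateFinset hgh A] with v hv
  exact lintegral_congr_ae hv

end Marginal

/-! ### Reference measures after an intervention -/

section DoMeasure

variable {V : Type*} [DecidableEq V] {E : V → Type*} [∀ i, MeasurableSpace (E i)]
  {ν : ∀ i, Measure (E i)} {X : Finset V}

theorem doMeasure_of_mem (x : (i : X) → E i) (i : X) :
    doMeasure ν X x i = Measure.dirac (x i) :=
  dif_pos i.2

theorem doMeasure_of_notMem (x : (i : X) → E i) {i : V} (hi : i ∉ X) :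
    doMeasure ν X x i = ν i :=
  dif_neg hi

instance sigmaFinite_doMeasure [∀ i, SigmaFinite (ν i)] (x : (i : X) → E i) (i : V) :
    SigmaFinite (doMeasure ν X x i) := by
  unfold doMeasure
  split_ifs <;> infer_instance

theorem doMeasure_empty (x : (i : (∅ : Finset V)) → E i) : doMeasure ν ∅ x = ν :=
  funext fun i => doMeasure_of_notMem x (Finset.notMem_empty i)

/-- Integrating out the intervened variables substitutes the intervention value for them. -/
theorem lmarginal_doMeasure [∀ i, SigmaFinite (ν i)] (x : (i : X) → E i) {T : Finset V}
    (hT : X ⊆ T) {g : (∀ i, E i) → ℝ≥0∞} (hg : Measurable g) (v : ∀ i, E i) :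
    lmarginal (doMeasure ν X x) T g v =
      lmarginal ν (T \ X) g (Function.updateFinset v X x) := by
  conv_lhs => rw [← Finset.union_sdiff_of_subset hT,
    lmarginal_union _ g hg Finset.disjoint_sdiff]
  have h₁ : lmarginal (doMeasure ν X x) (T \ X) g = lmarginal ν (T \ X) g := by
    ext v
    unfold lmarginal
    congr
    ext1 i
    exact doMeasure_of_notMem x (Finset.mem_sdiff.1 i.2).2
  have h₂ : Measure.pi (fun i : X => doMeasure ν X x i) = Measure.dirac x := by
    simp only [doMeasure_of_mem]
    refine Measure.pi_eq (μ := fun i : X => Measure.dirac (x i)) fun s hs => ?_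
    rw [Measure.dirac_apply' _ (.univ_pi hs)]
    simp only [Measure.dirac_apply' _ (hs _)]
    by_cases hx : ∀ i, x i ∈ s i
    · simp [Set.indicator_of_mem, hx]
    · obtain ⟨i, hi⟩ := not_forall.1 hx
      rw [Finset.prod_eq_zero (Finset.mem_univ i) (by simp [hi]),
        Set.indicator_of_notMem (by simpa using hx)]
  rw [h₁, lmarginal, h₂]
  exact lintegral_dirac' x ((hg.lmarginal ν).comp measurable_updateFinset)

variable [Fintype V]

theorem ae_doMeasure_eq [∀ i, MeasurableSingletonClass (E i)] [∀ i, SigmaFinite (ν i)]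
    (x : (i : X) → E i) : ∀ᵐ v ∂Measure.pi (doMeasure ν X x), ∀ i : X, v i = x i := by
  refine ae_all_iff.2 fun i => ?_
  have h : ∀ᵐ a ∂doMeasure ν X x i, a = x i := by
    rw [doMeasure_of_mem, ae_dirac_eq]
    exact rfl
  have h' := Measure.tendsto_eval_ae_ae (μ := doMeasure ν X x) (i := i)
  exact h'.eventually h

/-- The measure after `do(x)` of a set is the reference measure of its slice at `x`, so a null set
has null slices for almost every `x`. -/
theorem ae_ae_doMeasure [∀ i, SigmaFinite (ν i)] {P : (∀ i, E i) → Prop}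
    (hP : ∀ᵐ v ∂Measure.pi ν, P v) :
    ∀ᵐ x ∂Measure.pi (fun i : X => ν i), ∀ᵐ v ∂Measure.pi (doMeasure ν X x), P v := by
  rcases isEmpty_or_nonempty (∀ i, E i) with h | ⟨⟨v₀⟩⟩
  · exact .of_forall fun x => .of_forall fun v => (h.false v).elim
  obtain ⟨N, hN, hNm, hN0⟩ := exists_measurable_superset_of_null (ae_iff.1 hP)
  have hg : Measurable (N.indicator (1 : (∀ i, E i) → ℝ≥0∞)) := measurable_one.indicator hNm
  have h := lmarginal_lmarginal_compl hg (μ := ν) X v₀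
  rw [lintegral_indicator_one hNm, hN0] at h
  have h' := (lintegral_eq_zero_iff ((hg.lmarginal ν).comp measurable_updateFinset)).1 h
  filter_upwards [h'] with x hx
  have hN' : Measure.pi (doMeasure ν X x) N = 0 := by
    rw [← lintegral_indicator_one hNm, lintegral_eq_lmarginal_univ v₀,
      lmarginal_doMeasure x (Finset.subset_univ X) hg, ← Finset.compl_eq_univ_sdiff]
    exact hx
  exact ae_iff.2 (measure_mono_null hN hN')

end DoMeasure

/-! ### Marginal densities, kernels and pruning -/

section Density

variable {V : Type*} [Fintype V] [DecidableEq V] {E : V → Type*} [∀ i, MeasurableSpace (E i)]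
  {ν : ∀ i, Measure (E i)} {f : (∀ i, E i) → ℝ≥0∞} {D : Digraph V}

theorem dependsOn_marginalDensity (A : Finset V) : DependsOn (marginalDensity ν f A) A := by
  have := dependsOn_lmarginal ν f Aᶜ
  rwa [Finset.coe_compl, compl_compl] at this

theorem dependsOn_conditionalDensity (B A : Finset V) :
    DependsOn (conditionalDensity ν f B A) (B ∪ A : Finset V) := by
  intro v w h
  unfold conditionalDensity
  rw [dependsOn_marginalDensity _ h,
    dependsOn_marginalDensity A fun i hi => h i (by simpa using .inr hi)]

variable [∀ i, SigmaFinite (ν i)]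

theorem measurable_marginalDensity (hf : Measurable f) (A : Finset V) :
    Measurable (marginalDensity ν f A) :=
  hf.lmarginal ν

theorem measurable_conditionalDensity (hf : Measurable f) (B A : Finset V) :
    Measurable (conditionalDensity ν f B A) :=
  (measurable_marginalDensity hf _).div (measurable_marginalDensity hf _)

theorem lmarginal_marginalDensity (hf : Measurable f) {A B : Finset V} (hAB : Disjoint A B) :
    lmarginal ν A (marginalDensity ν f (A ∪ B)) = marginalDensity ν f B := by
  unfold marginalDensity
  rw [← lmarginal_union ν f hf]
  · congr 1
    ext i
    have : i ∈ A → i ∉ B := fun h => Finset.disjoint_left.1 hAB h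
    simp only [Finset.mem_union, Finset.mem_compl]
    tauto
  · exact disjoint_compl_right.mono_right (Finset.compl_subset_compl.2 Finset.subset_union_left)

/-- The marginals of a positive probability density are positive and finite. -/
theorem ae_marginalDensity_ne (hf : Measurable f) (h1 : ∫⁻ v, f v ∂Measure.pi ν = 1)
    (hpos : ∀ᵐ v ∂Measure.pi ν, 0 < f v) (A : Finset V) :
    ∀ᵐ v ∂Measure.pi ν, marginalDensity ν f A v ≠ 0 ∧ marginalDensity ν f A v ≠ ∞ := by
  obtain ⟨v₀⟩ : Nonempty (∀ i, E i) := by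
    by_contra h
    rw [not_nonempty_iff] at h
    simp [lintegral_of_isEmpty] at h1
  have hm := measurable_marginalDensity (ν := ν) hf A
  -- The bad set depends on the coordinates in `A` only, so the integral of `f` over it is that of
  -- the marginal. This vanishes, since the marginal is almost everywhere finite; positivity of `f`
  -- then makes the bad set null.
  let N : Set (∀ i, E i) := {v | marginalDensity ν f A v = 0 ∨ marginalDensity ν f A v = ∞}
  have hN : MeasurableSet N :=
    (hm (measurableSet_singleton 0)).union (hm (measurableSet_singleton ∞))
  have hg : Measurable (N.indicator (1 : (∀ i, E i) → ℝ≥0∞)) := measurable_one.indicator hN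
  have hgd : DependsOn (N.indicator (1 : (∀ i, E i) → ℝ≥0∞)) A := by
    intro v w h
    have := dependsOn_marginalDensity (ν := ν) (f := f) A h
    simp only [Set.indicator, N, Set.mem_ofPred_eq, this, Pi.one_apply]
  have hfin : ∀ᵐ y ∂Measure.pi (fun i : A => ν i),
      marginalDensity ν f A (Function.updateFinset v₀ A y) < ∞ := by
    refine ae_lt_top (hm.comp measurable_updateFinset) ?_
    have := lmarginal_lmarginal_compl (μ := ν) hf A v₀
    rw [h1] at this
    exact this.trans_ne ENNReal.one_ne_top
  have hint : ∫⁻ v, N.indicator 1 v * f v ∂Measure.pi ν = 0 := by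
    rw [← lmarginal_lmarginal_compl (g := fun v => N.indicator 1 v * f v) (hg.mul hf) A v₀]
    have h : lmarginal ν Aᶜ (fun v => N.indicator 1 v * f v) =
        fun v => N.indicator 1 v * marginalDensity ν f A v :=
      lmarginal_mul_left hgd (by simp [disjoint_compl_right]) hf
    rw [h]
    refine (lintegral_congr_ae ?_).trans lintegral_zero
    filter_upwards [hfin] with y hy
    by_cases h0 : marginalDensity ν f A (Function.updateFinset v₀ A y) = 0
    · simp [h0]
    · simp [N, Set.indicator, h0, hy.ne]
  filter_upwards [(lintegral_eq_zero_iff (hg.mul hf)).1 hint, hpos] with v hv hfv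
  have : v ∉ N := by
    intro h
    simp [h, hfv.ne'] at hv
  simpa [N] using this

/-- The kernel of a node integrates to one. -/
theorem lmarginal_conditionalDensity (hf : Measurable f)
    (h1 : ∫⁻ v, f v ∂Measure.pi ν = 1) (hpos : ∀ᵐ v ∂Measure.pi ν, 0 < f v) {A B : Finset V}
    (hAB : Disjoint B A) : lmarginal ν B (conditionalDensity ν f B A) =ᵐ[Measure.pi ν] 1 := by
  have hd : DependsOn (fun v => (marginalDensity ν f A v)⁻¹) A := fun v w h => by
    simp only [dependsOn_marginalDensity A h]
  have h : lmarginal ν B (conditionalDensity ν f B A) =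
      fun v => marginalDensity ν f A v * (marginalDensity ν f A v)⁻¹ := by
    have := lmarginal_mul_right (μ := ν) hd (T := B) (by exact_mod_cast hAB.symm)
      (measurable_marginalDensity (ν := ν) hf (B ∪ A))
    rwa [lmarginal_marginalDensity hf hAB] at this
  filter_upwards [ae_marginalDensity_ne hf h1 hpos A] with v hv
  rw [h]
  exact ENNReal.mul_inv_cancel hv.1 hv.2

/-- The kernel `f(v_i | pa(v_i))` of the node `i`. -/
noncomputable def nodeKernel (D : Digraph V) (ν : ∀ i, Measure (E i)) (f : (∀ i, E i) → ℝ≥0∞)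
    (i : V) : (∀ i, E i) → ℝ≥0∞ :=
  conditionalDensity ν f {i} (D.parents i)

omit [DecidableEq V] in
theorem Digraph.mem_parents {i j : V} : j ∈ D.parents i ↔ D.Adj j i := by
  simp [Digraph.parents]

omit [∀ i, SigmaFinite (ν i)] in
theorem dependsOn_nodeKernel (i : V) {s : Set V} (hs : ∀ j, j = i ∨ D.Adj j i → j ∈ s) :
    DependsOn (nodeKernel D ν f i) s :=
  (dependsOn_conditionalDensity {i} (D.parents i)).mono fun j hj => hs j (by
    simpa [Digraph.mem_parents] using hj)

theorem measurable_nodeKernel (hf : Measurable f) (i : V) : Measurable (nodeKernel D ν f i) :=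
  measurable_conditionalDensity hf _ _

theorem measurable_prod_nodeKernel (hf : Measurable f) (K : Finset V) :
    Measurable fun v => ∏ i ∈ K, nodeKernel D ν f i v :=
  Finset.measurable_fun_prod _ fun i _ => measurable_nodeKernel hf i

omit [DecidableEq V] in
theorem Digraph.IsDAG.exists_sink (hD : D.IsDAG) {U : Finset V} (hU : U.Nonempty) :
    ∃ u ∈ U, ∀ i ∈ U, ¬ D.Adj u i := by
  have : IsTrans V (Function.swap (Relation.TransGen D.Adj)) := ⟨fun _ _ _ h h' => h'.trans h⟩
  have : Std.Irrefl (Function.swap (Relation.TransGen D.Adj)) := ⟨hD⟩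
  obtain ⟨u, hu, h⟩ :=
    (Finite.wellFounded_of_trans_of_irrefl (Function.swap (Relation.TransGen D.Adj))).has_min
      (U : Set V) hU
  exact ⟨u, hu, fun i hi hui => h i hi (.single hui)⟩

/-- A set of nodes without children outside it is removed by integrating it out. -/
theorem lmarginal_prod_nodeKernel (hD : D.IsDAG) (hf : Measurable f)
    (h1 : ∫⁻ v, f v ∂Measure.pi ν = 1) (hpos : ∀ᵐ v ∂Measure.pi ν, 0 < f v) {U K : Finset V}
    (hUK : U ⊆ K) (hch : ∀ i ∈ K \ U, ∀ j ∈ U, ¬ D.Adj j i) :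
    lmarginal ν U (fun v => ∏ i ∈ K, nodeKernel D ν f i v) =ᵐ[Measure.pi ν]
      fun v => ∏ i ∈ K \ U, nodeKernel D ν f i v := by
  induction hn : U.card generalizing U K with
  | zero =>
    obtain rfl := Finset.card_eq_zero.1 hn
    simp
  | succ n ih =>
    obtain ⟨u, hu, hsink⟩ := hD.exists_sink (U := U) (Finset.card_pos.1 (by omega))
    have hK : K \ U = K.erase u \ U.erase u := by
      ext i
      by_cases hi : i = u
      · simp [hi, hu]
      · simp [hi]
    rw [hK] at hch ⊢
    have hstep : lmarginal ν {u} (fun v => ∏ i ∈ K, nodeKernel D ν f i v) =ᵐ[Measure.pi ν]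
        fun v => ∏ i ∈ K.erase u, nodeKernel D ν f i v := by
      -- A kernel other than that of `u` involves `u` only at a child of `u`: none lies in `U` as
      -- `u` is a sink there, and none in `K \ U` by assumption.
      have hdep : DependsOn (fun v => ∏ i ∈ K.erase u, nodeKernel D ν f i v) ({u} : Set V)ᶜ := by
        refine DependsOn.finset_prod fun i hi => dependsOn_nodeKernel i ?_
        rintro j hj rfl
        have hiu := Finset.ne_of_mem_erase hi
        have hji := hj.resolve_left hiu.symm
        by_cases hiU : i ∈ U
        · exact hsink i hiU hji
        · exact hch i (by simp [Finset.mem_of_mem_erase hi, hiu, hiU]) _ hu hji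
      have hmul := lmarginal_mul_right (μ := ν) hdep (T := {u}) (by simp)
        (measurable_nodeKernel (D := D) (ν := ν) hf u)
      have hprod : (fun v => ∏ i ∈ K, nodeKernel D ν f i v) =
          fun v => nodeKernel D ν f u v * ∏ i ∈ K.erase u, nodeKernel D ν f i v :=
        funext fun v => (Finset.mul_prod_erase K (fun i => nodeKernel D ν f i v) (hUK hu)).symm
      rw [hprod, hmul]
      filter_upwards [lmarginal_conditionalDensity (ν := ν) hf h1 hpos (A := D.parents u) (B := {u})
        (by simpa [Digraph.mem_parents] using fun h => hD u (.single h))] with v hv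
      rw [nodeKernel, hv, Pi.one_apply, one_mul]
    have hU : U = U.erase u ∪ {u} := by
      rw [Finset.union_comm, ← Finset.insert_eq, Finset.insert_erase hu]
    conv_lhs => rw [hU, lmarginal_union ν _ (measurable_prod_nodeKernel hf K) (by simp)]
    refine (lmarginal_congr_ae hstep _).trans (ih (Finset.erase_subset_erase u hUK) ?_ ?_)
    · exact fun i hi j hj => hch i hi j (Finset.mem_of_mem_erase hj)
    · rw [Finset.card_erase_of_mem hu, hn, Nat.add_sub_cancel]

end Density

/-! ### Invariance, the back-door identity and adjustment -/

section Adjustment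

variable {V : Type*} [Fintype V] [DecidableEq V] {E : V → Type*} [∀ i, MeasurableSpace (E i)]
  {ν : ∀ i, Measure (E i)} [∀ i, SigmaFinite (ν i)] {f : (∀ i, E i) → ℝ≥0∞} {D : Digraph V}

theorem lmarginal_prod_nodeKernel_of_subset (hD : D.IsDAG) (hf : Measurable f)
    (h1 : ∫⁻ v, f v ∂Measure.pi ν = 1) (hpos : ∀ᵐ v ∂Measure.pi ν, 0 < f v) {U K T : Finset V}
    (hUT : U ⊆ T) (hUK : U ⊆ K) (hch : ∀ i ∈ K \ U, ∀ j ∈ U, ¬ D.Adj j i) :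
    lmarginal ν T (fun v => ∏ i ∈ K, nodeKernel D ν f i v) =ᵐ[Measure.pi ν]
      lmarginal ν (T \ U) fun v => ∏ i ∈ K \ U, nodeKernel D ν f i v := by
  conv_lhs => rw [← Finset.sdiff_union_of_subset hUT,
    lmarginal_union ν _ (measurable_prod_nodeKernel hf K) Finset.sdiff_disjoint]
  exact lmarginal_congr_ae (lmarginal_prod_nodeKernel hD hf h1 hpos hUK hch) _

/-- An intervention on `X` does not change the marginal density of non-descendants of `X`. -/
theorem lmarginal_prod_nodeKernel_compl (hD : D.IsDAG) (hf : Measurable f)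
    (h1 : ∫⁻ v, f v ∂Measure.pi ν = 1) (hpos : ∀ᵐ v ∂Measure.pi ν, 0 < f v)
    (hfk : f =ᵐ[Measure.pi ν] fun v => ∏ i, nodeKernel D ν f i v) {X W : Finset V}
    (hW : Disjoint (W : Set V) (D.descendants X)) :
    lmarginal ν (X ∪ W)ᶜ (fun v => ∏ i ∈ Xᶜ, nodeKernel D ν f i v) =ᵐ[Measure.pi ν]
      marginalDensity ν f W := by
  classical
  let A : Finset V := Finset.univ.filter fun i => i ∈ D.descendants X
  have hA : ∀ i, i ∈ A ↔ i ∈ D.descendants X := by simp [A]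
  have hXA : X ⊆ A := fun i hi => (hA i).2 (Digraph.subset_descendants _ hi)
  have hWA : ∀ i ∈ W, i ∉ A := fun i hi h => hW.ne_of_mem hi ((hA i).1 h) rfl
  have hch : ∀ i ∉ A, ∀ j ∈ A, ¬ D.Adj j i := by
    intro i hi j hj hji
    obtain ⟨x, hx, hxj⟩ := (hA j).1 hj
    exact hi ((hA i).2 ⟨x, hx, hxj.tail hji⟩)
  have hdo := lmarginal_prod_nodeKernel_of_subset (U := A \ X) (K := Xᶜ) (T := (X ∪ W)ᶜ) hD hf h1
    hpos (fun i => by have := hWA i; simp only [Finset.mem_sdiff, Finset.mem_compl,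
      Finset.mem_union]; tauto) (fun i => by simp)
    fun i hi j hj => hch i (by simp at hi; tauto) j (Finset.mem_sdiff.1 hj).1
  have hobs := (lmarginal_congr_ae hfk Wᶜ).trans (lmarginal_prod_nodeKernel_of_subset (U := A)
    hD hf h1 hpos (fun i hi => Finset.mem_compl.2 fun h => hWA i h hi) (Finset.subset_univ A)
    fun i hi => hch i (Finset.mem_sdiff.1 hi).2)
  -- Both prunings leave the kernels outside `A`, integrated over the same set.
  have hset₁ : (X ∪ W)ᶜ \ (A \ X) = Wᶜ \ A := by
    ext i
    have := @hXA i
    simp only [Finset.mem_sdiff, Finset.mem_compl, Finset.mem_union]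
    tauto
  have hset₂ : Xᶜ \ (A \ X) = Finset.univ \ A := by
    ext i
    have := @hXA i
    simp only [Finset.mem_sdiff, Finset.mem_compl, Finset.mem_univ]
    tauto
  rw [hset₁, hset₂] at hdo
  exact hdo.trans hobs.symm

/-- The back-door criterion in product form: after an intervention on `X`, the conditional density
of `Y` given `X ∪ W` is the observational one. -/
theorem marginalDensity_mul_lmarginal_prod_nodeKernel (hD : D.IsDAG) (hf : Measurable f)
    (h1 : ∫⁻ v, f v ∂Measure.pi ν = 1) (hpos : ∀ᵐ v ∂Measure.pi ν, 0 < f v)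
    (hfk : f =ᵐ[Measure.pi ν] fun v => ∏ i, nodeKernel D ν f i v) {X Y W : Finset V}
    (hXY : Disjoint X Y) (hXW : Disjoint X W)
    (hW : ∀ p, D.IsPath X Y p → IsProperPath (X : Set V) p → D.IsBackDoorPath p →
      D.Blocks W p) :
    ∀ᵐ v ∂Measure.pi ν, marginalDensity ν f (X ∪ Y ∪ W) v *
        lmarginal ν (X ∪ W)ᶜ (fun v => ∏ i ∈ Xᶜ, nodeKernel D ν f i v) v =
      lmarginal ν (X ∪ Y ∪ W)ᶜ (fun v => ∏ i ∈ Xᶜ, nodeKernel D ν f i v) v *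
        marginalDensity ν f (X ∪ W) v := by
  classical
  obtain ⟨R', hXR, hRW, hRY, hRA, hR⟩ := Digraph.exists_separating_set (X := X) (Y := Y) (C := W)
    hD (by exact_mod_cast hXY) (by exact_mod_cast hXW) hW
  obtain ⟨R, rfl⟩ : ∃ R : Finset V, (R : Set V) = R' := ⟨R'.toFinset, by simp⟩
  obtain ⟨A, hA⟩ : ∃ A : Finset V, (A : Set V) = D.ancestors (X ∪ Y ∪ W) :=
    ⟨(D.ancestors (X ∪ Y ∪ W)).toFinset, by simp⟩
  have hSA : X ∪ Y ∪ W ⊆ A := by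
    have := Digraph.subset_ancestors (D := D) (X ∪ Y ∪ W : Set V)
    rw [← hA] at this
    rw [← Finset.coe_subset]
    simpa [and_assoc] using this
  have hch : ∀ i ∈ A, ∀ j ∉ A, ¬ D.Adj j i := by
    simp only [← Finset.mem_coe, hA]
    exact fun i hi j hj hji => hj (Digraph.mem_ancestors_of_adj hi hji)
  rw [← hA] at hRA hR
  norm_cast at hXR hRW hRY hRA
  -- `p` selects the kernels that depend on `R ∪ W` only; those of `X` are among them, because the
  -- other alternative in `hR` excludes `X`.
  let p : V → Prop := fun i => ∀ j, j = i ∨ D.Adj j i → j ∈ R ∪ W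
  have hXp : ∀ i ∈ X, p i := by
    intro i hi
    rcases hR i (hRA (hXR hi)) with h | h
    · exact fun j hj => by simpa using h j hj
    · exact (h.1 hi).elim
  let g : Finset V → (∀ i, E i) → ℝ≥0∞ := fun K v => ∏ i ∈ K, nodeKernel D ν f i v
  have hgm : ∀ K, Measurable (g K) := measurable_prod_nodeKernel hf
  have hsplit : ∀ K, g K = fun v => g (K.filter p) v * g (K.filter fun i => ¬ p i) v :=
    fun K => funext fun v => (Finset.prod_filter_mul_prod_filter_not K p _).symm
  have hg₁ : ∀ K : Finset V, DependsOn (g (K.filter p)) (R ∪ W : Finset V) := fun K =>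
    DependsOn.finset_prod fun i hi => dependsOn_nodeKernel i (Finset.mem_filter.1 hi).2
  have hg₂ : ∀ K : Finset V, K ⊆ A →
      DependsOn (g (K.filter fun i => ¬ p i)) ((R \ X : Finset V) : Set V)ᶜ := by
    refine fun K hK => DependsOn.finset_prod fun i hi => dependsOn_nodeKernel i fun j hj => ?_
    rw [Finset.mem_filter] at hi
    rcases hR i (hK hi.1) with h | h
    · exact (hi.2 fun j hj => by simpa using h j hj).elim
    · simpa using h.2 j hj
  have hprod : ∀ K ⊆ A, ∀ T : Finset V, Disjoint T (R ∪ W) →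
      lmarginal ν (R \ X ∪ T) (g K) = fun v => lmarginal ν (R \ X) (g (K.filter p)) v *
        lmarginal ν T (g (K.filter fun i => ¬ p i)) v := by
    intro K hK T hT
    conv_lhs => rw [hsplit K]
    refine lmarginal_union_mul ?_ (hg₁ K) ?_ (hg₂ K hK) disjoint_compl_left (hgm _) (hgm _)
    · exact (hT.mono_right (Finset.sdiff_subset.trans Finset.subset_union_left)).symm
    · exact_mod_cast hT.symm
  -- `A` is closed under parents, so the nodes outside it have no children in `A` and integrate out.
  have hprune : ∀ B ⊆ X ∪ Y ∪ W, ∀ K, Aᶜ ⊆ K →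
      lmarginal ν Bᶜ (g K) =ᵐ[Measure.pi ν] lmarginal ν (A \ B) (g (A ∩ K)) := by
    intro B hB K hK
    have h := lmarginal_prod_nodeKernel_of_subset (U := Aᶜ) (K := K) (T := Bᶜ) hD hf h1 hpos
      (Finset.compl_subset_compl.2 (hB.trans hSA)) hK fun i hi j hj => by
        simp only [Finset.mem_sdiff, Finset.mem_compl, not_not] at hi hj
        exact hch i hi.2 j hj
    have h₁ : Bᶜ \ Aᶜ = A \ B := by ext i; simp [and_comm]
    have h₂ : K \ Aᶜ = A ∩ K := by ext i; simp [and_comm]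
    rwa [h₁, h₂] at h
  have hYR : A \ (X ∪ Y ∪ W) = R \ X ∪ A \ (R ∪ W ∪ Y) := by
    ext i
    have h₁ : i ∈ R → i ∉ W := fun h => Finset.disjoint_left.1 hRW h
    have h₂ : i ∈ R → i ∉ Y := fun h => Finset.disjoint_left.1 hRY h
    have h₃ := @hXR i
    have h₄ := @hRA i
    simp only [Finset.mem_sdiff, Finset.mem_union]
    tauto
  have hR' : A \ (X ∪ W) = R \ X ∪ A \ (R ∪ W) := by
    ext i
    have h₁ : i ∈ R → i ∉ W := fun h => Finset.disjoint_left.1 hRW h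
    have h₃ := @hXR i
    have h₄ := @hRA i
    simp only [Finset.mem_sdiff, Finset.mem_union]
    tauto
  have hXA : Aᶜ ⊆ Xᶜ := Finset.compl_subset_compl.2 (hXR.trans hRA)
  have hsub : X ∪ W ⊆ X ∪ Y ∪ W := Finset.union_subset_union_left Finset.subset_union_left
  have hd₁ : Disjoint (A \ (R ∪ W ∪ Y)) (R ∪ W) :=
    Finset.sdiff_disjoint.mono_right Finset.subset_union_left
  have hd₂ : Disjoint (A \ (R ∪ W)) (R ∪ W) := Finset.sdiff_disjoint
  -- The intervention leaves the second factor unchanged.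
  have hnot : (A ∩ Xᶜ).filter (fun i => ¬ p i) = (A ∩ Finset.univ).filter fun i => ¬ p i := by
    ext i
    have := hXp i
    simp only [Finset.mem_filter, Finset.mem_inter, Finset.mem_compl, Finset.mem_univ, and_true]
    tauto
  have hK : ∀ K, A ∩ K ⊆ A := fun K => Finset.inter_subset_left
  filter_upwards [(lmarginal_congr_ae hfk (X ∪ Y ∪ W)ᶜ).trans
      (hprune _ subset_rfl _ (Finset.subset_univ _)),
    (lmarginal_congr_ae hfk (X ∪ W)ᶜ).trans (hprune _ hsub _ (Finset.subset_univ _)),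
    hprune _ subset_rfl _ hXA, hprune _ hsub _ hXA] with v e₁ e₂ e₃ e₄
  simp only [hYR, hR', hprod _ (hK _) _ hd₁, hprod _ (hK _) _ hd₂, hnot] at e₁ e₂ e₃ e₄
  unfold marginalDensity
  rw [e₁, e₂, e₃, e₄]
  ring

/-- The adjustment formula, with the truncated factorization in place of the interventional
density. -/
theorem lmarginal_prod_nodeKernel_div (hD : D.IsDAG) (hf : Measurable f)
    (h1 : ∫⁻ v, f v ∂Measure.pi ν = 1) (hpos : ∀ᵐ v ∂Measure.pi ν, 0 < f v)
    (hfk : f =ᵐ[Measure.pi ν] fun v => ∏ i, nodeKernel D ν f i v) {X Y Z S : Finset V}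
    (hXY : Disjoint X Y) (hXZ : Disjoint X Z) (hXS : Disjoint X S) (hYS : Disjoint Y S)
    (hZS : Disjoint Z S) (hZ : Disjoint (Z : Set V) (D.descendants (X : Set V)))
    (hS : D.ConditionalBackDoorCriterion (X : Set V) (Y : Set V) (Z : Set V) (S : Set V)) :
    ∀ᵐ v ∂Measure.pi ν,
      lmarginal ν (X ∪ Y ∪ Z)ᶜ (fun v => ∏ i ∈ Xᶜ, nodeKernel D ν f i v) v /
        lmarginal ν (X ∪ Z)ᶜ (fun v => ∏ i ∈ Xᶜ, nodeKernel D ν f i v) v =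
        if S = ∅ then conditionalDensity ν f Y (X ∪ Z) v
        else lmarginal ν S (fun v' => conditionalDensity ν f Y (X ∪ Z ∪ S) v' *
          conditionalDensity ν f S Z v') v := by
  have hne := ae_marginalDensity_ne hf h1 hpos
  have hbd := marginalDensity_mul_lmarginal_prod_nodeKernel (W := S ∪ Z) hD hf h1 hpos hfk hXY
    (Finset.disjoint_union_right.2 ⟨hXS, hXZ⟩) (by simpa using hS.blocks)
  have hMZ := lmarginal_prod_nodeKernel_compl hD hf h1 hpos hfk hZ
  split_ifs with hS0
  · subst hS0
    rw [Finset.empty_union] at hbd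
    filter_upwards [hbd, hMZ, hne Z, hne (X ∪ Z)] with v hv hZv hZ0 hXZ0
    have hset : Y ∪ (X ∪ Z) = X ∪ Y ∪ Z := by
      rw [← Finset.union_assoc, Finset.union_comm Y]
    rw [hZv] at hv
    rw [hZv, conditionalDensity, hset, ENNReal.div_eq_div_iff hXZ0.1 hXZ0.2 hZ0.1 hZ0.2, mul_comm,
      ← hv, mul_comm]
  · have hMW := lmarginal_prod_nodeKernel_compl (W := S ∪ Z) hD hf h1 hpos hfk (by
      simpa using ⟨hS.disjoint_descendants, hZ⟩)
    have hset₁ : X ∪ Z ∪ S = X ∪ (S ∪ Z) := by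
      rw [Finset.union_assoc, Finset.union_comm Z]
    have hset₂ : Y ∪ (X ∪ (S ∪ Z)) = X ∪ Y ∪ (S ∪ Z) := by
      rw [← Finset.union_assoc, Finset.union_comm Y]
    -- By invariance the back-door identity reads f(x,y,w) f(w) = f(y,w | do(x)) f(x,w); the
    -- numerator f(w) of f(s | z) supplies the missing factor.
    have hint : (fun v => conditionalDensity ν f Y (X ∪ Z ∪ S) v * conditionalDensity ν f S Z v)
        =ᵐ[Measure.pi ν] fun v =>
          lmarginal ν (X ∪ Y ∪ (S ∪ Z))ᶜ (fun v => ∏ i ∈ Xᶜ, nodeKernel D ν f i v) v *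
            (marginalDensity ν f Z v)⁻¹ := by
      filter_upwards [hbd, hMW, hne (X ∪ (S ∪ Z))] with v hv hWv h0
      rw [hWv] at hv
      rw [conditionalDensity, conditionalDensity, hset₁, hset₂, div_eq_mul_inv, div_eq_mul_inv,
        ← mul_assoc, mul_right_comm (marginalDensity ν f (X ∪ Y ∪ (S ∪ Z)) v), hv, mul_assoc,
        mul_assoc, ← mul_assoc (marginalDensity ν f (X ∪ (S ∪ Z)) v),
        ENNReal.mul_inv_cancel h0.1 h0.2, one_mul]
    have hd : DependsOn (fun v => (marginalDensity ν f Z v)⁻¹) Z := fun v w h => by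
      simp only [dependsOn_marginalDensity Z h]
    have hset₃ : S ∪ (X ∪ Y ∪ (S ∪ Z))ᶜ = (X ∪ Y ∪ Z)ᶜ := by
      ext i
      have h₁ : i ∈ X → i ∉ S := fun h => Finset.disjoint_left.1 hXS h
      have h₂ : i ∈ Y → i ∉ S := fun h => Finset.disjoint_left.1 hYS h
      have h₃ : i ∈ Z → i ∉ S := fun h => Finset.disjoint_left.1 hZS h
      simp only [Finset.mem_compl, Finset.mem_union]
      tauto
    have hdS : Disjoint S (X ∪ Y ∪ (S ∪ Z))ᶜ := disjoint_compl_right.mono_right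
      (Finset.compl_subset_compl.2 (Finset.subset_union_left.trans Finset.subset_union_right))
    filter_upwards [lmarginal_congr_ae hint S, hMZ] with v hv hZv
    rw [hv, lmarginal_mul_right hd (by exact_mod_cast hZS)
      ((measurable_prod_nodeKernel hf _).lmarginal ν),
      ← lmarginal_union ν _ (measurable_prod_nodeKernel hf _) hdS, hset₃, hZv, div_eq_mul_inv]

/-- Densities after an intervention are marginals of the truncated factorization. -/
theorem ae_lmarginal_doMeasure [∀ i, MeasurableSingletonClass (E i)] (hf : Measurable f)
    {X T : Finset V} (hXT : X ⊆ T) (x : (i : X) → E i) {g : (∀ i, E i) → ℝ≥0∞}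
    (hg : g =ᵐ[Measure.pi (doMeasure ν X x)] truncatedFactorization D ν f X x) :
    lmarginal (doMeasure ν X x) T g =ᵐ[Measure.pi (doMeasure ν X x)]
      lmarginal ν (T \ X) fun v => ∏ i ∈ Xᶜ, nodeKernel D ν f i v := by
  have hg' : g =ᵐ[Measure.pi (doMeasure ν X x)] fun v => ∏ i ∈ Xᶜ, nodeKernel D ν f i v := by
    filter_upwards [hg, ae_doMeasure_eq x] with v hv hx
    rw [hv]
    exact Set.indicator_of_mem (s := {v : ∀ i, E i | ∀ i : X, v i = x i}) hx _
  filter_upwards [lmarginal_congr_ae hg' T, ae_doMeasure_eq x] with v hv hx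
  have hvx : Function.updateFinset v X x = v := by
    ext i
    simp only [Function.updateFinset_def]
    split_ifs with hi
    · exact (hx ⟨i, hi⟩).symm
    · rfl
  rw [hv, lmarginal_doMeasure x hXT (measurable_prod_nodeKernel hf _), hvx]

omit [∀ i, SigmaFinite (ν i)] in
-- This is the truncated factorization for the empty intervention, whose value ranges over a single
-- point of full mass.
theorem IsCompatibleFamily.obs_ae_eq [∀ i, MeasurableSingletonClass (E i)]
    {F : InterventionalFamily E} (hF : IsCompatibleFamily D ν F) :
    F.obs =ᵐ[Measure.pi ν] fun v => ∏ i, nodeKernel D ν F.obs i v := by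
  have h := hF.truncated ∅
  rw [Measure.pi_of_empty, ae_dirac_eq, Filter.eventually_pure, doMeasure_empty] at h
  have hobs : F ∅ (fun i => isEmptyElim i) = F.obs := congrArg (F ∅) (Subsingleton.elim _ _)
  rw [hobs] at h
  filter_upwards [h] with v hv
  rw [hv]
  simp [truncatedFactorization, nodeKernel]

end Adjustment

theorem lemmaE1 {V : Type u} [Fintype V] [DecidableEq V] (D : Digraph V) (hD : D.IsDAG)
    (X Y Z S : Finset V)
    (hXY : Disjoint X Y) (hXZ : Disjoint X Z) (hXS : Disjoint X S)
    (hYZ : Disjoint Y Z) (hYS : Disjoint Y S) (hZS : Disjoint Z S)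
    (hZ : Disjoint (Z : Set V) (D.descendants (X : Set V)))
    (hS : D.ConditionalBackDoorCriterion (X : Set V) (Y : Set V) (Z : Set V) (S : Set V)) :
    IsConditionalAdjustmentSet.{u, w} D X Y Z S := by
  intro E _ _ ν _ F hF
  have hf := hF.measurable_obs
  have hXYZ : X ⊆ (Y ∪ Z)ᶜ :=
    Finset.subset_compl_iff_disjoint_right.2 (Finset.disjoint_union_right.2 ⟨hXY, hXZ⟩)
  have hXZ' : X ⊆ Zᶜ := Finset.subset_compl_iff_disjoint_right.2 hXZ
  -- Numerator and denominator of f(y | do(x), z) both integrate out all of `X`, which merely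
  -- substitutes `x`; the adjustment formula then transfers from the reference measure to almost
  -- every `x`.
  filter_upwards [hF.truncated X, ae_ae_doMeasure (lmarginal_prod_nodeKernel_div hD hf
    hF.lintegral_obs hF.pos_obs hF.obs_ae_eq hXY hXZ hXS hYS hZS hZ hS)] with x hx hadj
  filter_upwards [ae_lmarginal_doMeasure hf hXYZ x hx, ae_lmarginal_doMeasure hf hXZ' x hx, hadj]
    with v h₁ h₂ h₃
  have hset₁ : (Y ∪ Z)ᶜ \ X = (X ∪ Y ∪ Z)ᶜ := by
    ext i
    simp only [Finset.mem_sdiff, Finset.mem_compl, Finset.mem_union]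
    tauto
  have hset₂ : Zᶜ \ X = (X ∪ Z)ᶜ := by
    ext i
    simp only [Finset.mem_sdiff, Finset.mem_compl, Finset.mem_union]
    tauto
  rw [← h₃, conditionalDensity, marginalDensity, marginalDensity, h₁, h₂, hset₁, hset₂]
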